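/- Let $V$ be a finite set. A degree constraint over $V$ is a triple $(\mathcal X,\mathcal Y,N)$ with $\mathcal X\subsetneq\mathcal Y\subseteq V$ and $N\ge 1$ an integer. For a set $\mathsf{DC}$ of degree constraints, its dependency graph is the directed graph on $V$ that has the edge $(X,Y)$ whenever $X\in\mathcal X$ and $Y\in\mathcal Y\setminus\mathcal X$ for some $(\mathcal X,\mathcal Y,N)\in\mathsf{DC}$; $\mathsf{DC}$ is called acyclic if this graph has no directed cycle, and cyclic otherwise. The polymatroid bound of $\mathsf{DC}$ is $$\mathit{polymat}(\mathsf{DC})=2^{\max_h h(V)},$$ where $h$ ranges over all functions $h:2^{V}\to\mathbb R_{\ge 0}$ that are zero-grounded ($h(\emptyset)=0$), monotone and submodular and satisfy $h(\mathcal Y)-h(\mathcal X)\le\log_2 N$ for every $(\mathcal X,\mathcal Y,N)\in\mathsf{DC}$. Lemma. For every integer $k\ge 0$ there are constants $c,C>0$, depending only on $k$, such that the following holds. Let $P=(V_P,E_P)$ be a simple (loopless, without parallel edges; antiparallel edges are allowed), weakly connected directed graph with $|V_P|=k$, let $m\ge 1$ and $\lambda\in[1,m]$ be integers, and let $\mathsf{DC}$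 be the set of degree constraints over $V_P$ consisting of $(\emptyset,\{X,Y\},m)$ and $(\{X\},\{X,Y\},\lambda)$ for each edge $(X,Y)\in E_P$. If $\mathsf{DC}$ is cyclic, then there is an acyclic proper subset $\mathsf{DC}'\subsetneq\mathsf{DC}$ such that $$c\cdot\mathit{polymat}(\mathsf{DC})\le\mathit{polymat}(\mathsf{DC}')\le C\cdot\mathit{polymat}(\mathsf{DC}),$$ that is, $\mathit{polymat}(\mathsf{DC}')=\Theta(\mathit{polymat}(\mathsf{DC}))$; here the maxima defining both polymatroid bounds exist. -/

import Mathlib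

namespace DegreeJoin

/-- A degree constraint `(X, Y, N)` over the finite attribute set `V`: here `X ⊂ Y` are sets of
attributes (strict inclusion) and `N ≥ 1` is an integer. -/
@[ext]
structure DegreeConstraint (V : Type*) where
  lower : Finset V
  upper : Finset V
  bound : ℕ
  lower_ssubset_upper : lower ⊂ upper
  one_le_bound : 1 ≤ bound

variable {V : Type*} [DecidableEq V]

/-- The constraint dependency graph of a set of degree constraints: each constraint `(X, Y, N)`
contributes the edges from every `x ∈ X` to every `y ∈ Y \ X`
(constraints with `X = ∅` contribute none). -/
def dependencyGraph (DC : Set (DegreeConstraint V)) : Digraph V where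
  Adj x y := ∃ c ∈ DC, x ∈ c.lower ∧ y ∈ c.upper \ c.lower

/-- A set of degree constraints is acyclic if its dependency graph has no directed cycle, i.e.
no vertex can be reached from itself by a directed walk of positive length. -/
def AcyclicConstraints (DC : Set (DegreeConstraint V)) : Prop :=
  ∀ v : V, ¬ Relation.TransGen (dependencyGraph DC).Adj v v

/-- Membership of a set function in `Γ`: non-negative values, zero-grounded, monotone and
submodular. -/
structure IsPolymatroid (h : Finset V → ℝ) : Prop where
  nonneg : ∀ X, 0 ≤ h X
  zero_grounded : h ∅ = 0
  mono : ∀ X Y, X ⊆ Y → h X ≤ h Y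
  submodular : ∀ X Y, h (X ∪ Y) + h (X ∩ Y) ≤ h X + h Y

/-- The set functions in `Γ` that obey every constraint of `DC`:
`h Y - h X ≤ log₂ N` for all `(X, Y, N) ∈ DC`. -/
def feasible (DC : Set (DegreeConstraint V)) : Set (Finset V → ℝ) :=
  {h | IsPolymatroid h ∧ ∀ c ∈ DC, h c.upper - h c.lower ≤ Real.logb 2 c.bound}

variable [Fintype V]

/-- The maximum of `h V` over all feasible `h` exists (it is bounded and attained). -/
def PolymatExists (DC : Set (DegreeConstraint V)) : Prop :=
  ∃ h ∈ feasible DC, ∀ h' ∈ feasible DC, h' Finset.univ ≤ h Finset.univ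

/-- The polymatroid bound `2 ^ (max h V)`, the maximum ranging over all feasible `h`.
It is meaningful when `PolymatExists DC` holds. -/
noncomputable def polymat (DC : Set (DegreeConstraint V)) : ℝ :=
  (2 : ℝ) ^ sSup ((fun h : Finset V → ℝ => h Finset.univ) '' feasible DC)

/-- The degree constraints of a directed pattern `P`: for each edge `(x, y)` the constraints
`(∅, {x, y}, m)` and `({x}, {x, y}, lam)`. -/
def patternConstraints (P : Digraph V) (m lam : ℕ) : Set (DegreeConstraint V) :=
  {c | ∃ x y, P.Adj x y ∧
    ((c.lower = ∅ ∧ c.upper = {x, y} ∧ c.bound = m) ∨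
     (c.lower = {x} ∧ c.upper = {x, y} ∧ c.bound = lam))}

end DegreeJoin

/-!
Write `M = log₂ m` and `L = log₂ lam`. Dropping constraints only enlarges the feasible set, so the
point is to choose an acyclic `DC'` such that every polymatroid `h'` feasible for `DC'` can be
replaced by one that is feasible for all the constraints and has the same value on the full vertex
set. Both bounds are then equal, and `c = C = 1` works.

*Choice of `DC'`.* Pick one root in every strongly connected component that has no edge entering it
from outside (`IsRoot`). Every vertex is reachable from a root, so the distance `d` from the roots
is defined, and every non-root has an in-neighbour of smaller distance (`exists_level`). Keep all
the cardinality constraints, and those constraints `({x}, {x, y}, lam)` with `d x < d y`.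

*From `h'` to a weight.* The marginals of `h'` along a linear order refining `d` form a
weight `v ≥ 0` on the vertices with total `h' V`, with `v x + v y ≤ M` along every edge, and with
`v y ≤ L` at every non-root `y` (`IsPolymatroid.exists_marginals`, `IsEdgeWeight`).

*Shifting.* If a root `r` with an in-edge has `v r > max L (M - L)`, its neighbours carry less
than `min L (M - L)`, and the excess of `r` can be moved to one of its in-neighbours, which lies in
the component of `r` (`IsEdgeWeight.exists_shift`). So `v r ≤ max L (M - L)` may be assumed.

*From the weight to a polymatroid.* At a root `r` only `min (v r) L` is kept as private weight; the
rest `v r - L` is paid once by any set that meets the set of ancestors of `r`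
(`sharedWeight`). All vertices now have private weight at most `L`, and a source of an edge pays
for whatever is shared by its target, so all the constraints with bound `lam` hold. An edge whose
ends meet the ancestors of a root `r` with an in-edge costs at most `(v r - L) + 2 L ≤ M` when
the excess is positive, by the shifting step. This is `IsEdgeWeight.exists_feasible`.
-/

namespace DegreeJoin

open Relation

/-! ### Roots of the initial strongly connected components -/

section Roots

variable {V : Type*} {E : V → V → Prop} {e : V → ℕ}

/-- `r` lies in a strongly connected component that no edge enters from outside, and is the vertex
of that component with the smallest label `e`. -/
def IsRoot (E : V → V → Prop) (e : V → ℕ) (r : V) : Prop :=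
  ∀ z, ReflTransGen E z r → ReflTransGen E r z ∧ e r ≤ e z

/-- Distinct roots have disjoint sets of ancestors. -/
lemma IsRoot.eq_of_common_ancestor (he : Function.Injective e) {r s y : V} (hr : IsRoot E e r)
    (hs : IsRoot E e s) (hyr : ReflTransGen E y r) (hys : ReflTransGen E y s) : r = s := by
  have hrs : ReflTransGen E r s := (hr y hyr).1.trans hys
  have hsr : ReflTransGen E s r := (hs y hys).1.trans hyr
  exact he (le_antisymm (hr s hsr).2 (hs r hrs).2)

lemma exists_isRoot_reaching [Finite V] (x : V) : ∃ r, IsRoot E e r ∧ ReflTransGen E r x := by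
  classical
  -- An ancestor `z` of `x` with as few ancestors as possible lies in an initial component.
  obtain ⟨z, hzx, hz⟩ := Set.exists_min_image {z | ReflTransGen E z x}
    (fun z => {w | ReflTransGen E w z}.ncard) (Set.toFinite _) ⟨x, ReflTransGen.refl⟩
  have hback : ∀ w, ReflTransGen E w z → ReflTransGen E z w := by
    intro w hw
    have hsub : {a | ReflTransGen E a w} ⊆ {a | ReflTransGen E a z} := fun a ha => ha.trans hw
    have := Set.eq_of_subset_of_ncard_le hsub (hz w (hw.trans hzx)) (Set.toFinite _)
    have hmem : z ∈ {a | ReflTransGen E a w} := by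
      rw [this]
      exact ReflTransGen.refl
    exact hmem
  obtain ⟨r, hrz, hr⟩ := Set.exists_min_image {w | ReflTransGen E w z} e (Set.toFinite _)
    ⟨z, ReflTransGen.refl⟩
  exact ⟨r, fun w hw => ⟨hrz.trans (hback w (hw.trans hrz)), hr w (hw.trans hrz)⟩, hrz.trans hzx⟩

/-- If every vertex is reachable from `R`, then some level function (the distance from `R`)
strictly increases along at least one edge into each vertex outside `R`. -/
lemma exists_level {R : V → Prop} (hR : ∀ x, ∃ r, R r ∧ ReflTransGen E r x) :
    ∃ d : V → ℕ, ∀ y, ¬ R y → ∃ x, E x y ∧ d x < d y := by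
  classical
  let walk : ℕ → V → Prop := fun n =>
    Nat.rec (motive := fun _ => V → Prop) R (fun _ ih y => ∃ x, ih x ∧ E x y) n
  have hex : ∀ x, ∃ n, walk n x := by
    intro x
    obtain ⟨r, hr, hrx⟩ := hR x
    induction hrx with
    | refl => exact ⟨0, hr⟩
    | tail _ hyz ih =>
      obtain ⟨n, hn⟩ := ih
      exact ⟨n + 1, _, hn, hyz⟩
  refine ⟨fun x => Nat.find (hex x), fun y hy => ?_⟩
  have hspec := Nat.find_spec (hex y)
  rcases hn : Nat.find (hex y) with _ | n
  · rw [hn] at hspec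
    exact absurd hspec hy
  · rw [hn] at hspec
    obtain ⟨x, hx, hxy⟩ := hspec
    exact ⟨x, hxy, lt_of_lt_of_eq (Nat.lt_succ_of_le (Nat.find_min' (hex x) hx)) hn.symm⟩

/-- A level function refined to an injective one. -/
lemma exists_injective_refinement [Fintype V] (d : V → ℕ) :
    ∃ ρ : V → ℕ, Function.Injective ρ ∧ ∀ x y, d x < d y → ρ x < ρ y := by
  let f := Fintype.equivFin V
  have hlt : ∀ x y, d x < d y →
      d x * Fintype.card V + f x < d y * Fintype.card V + f y := fun x y h => by
    have h1 : (d x + 1) * Fintype.card V ≤ d y * Fintype.card V := Nat.mul_le_mul_right _ h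
    have h2 := (f x).2
    rw [add_mul, one_mul] at h1
    omega
  refine ⟨fun x => d x * Fintype.card V + f x, fun x y hxy => ?_, hlt⟩
  rcases lt_trichotomy (d x) (d y) with h | h | h
  · exact absurd hxy (hlt x y h).ne
  · simp only [h, add_right_inj] at hxy
    exact f.injective (Fin.ext hxy)
  · exact absurd hxy (hlt y x h).ne'

end Roots

/-! ### Marginals of a polymatroid -/

section Marginals

variable {V : Type*} [DecidableEq V]

lemma sum_marginals_eq (h : Finset V → ℝ) {ρ : V → ℕ} (hρ : Function.Injective ρ) (s : Finset V) :
    ∑ x ∈ s, (h {a ∈ s | ρ a ≤ ρ x} - h {a ∈ s | ρ a < ρ x}) = h s - h ∅ := by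
  induction s using Finset.induction_on_max_value ρ with
  | empty => simp
  | insert a s ha hmax ih =>
    have hlt : ∀ x ∈ s, ρ x < ρ a := fun x hx =>
      lt_of_le_of_ne (hmax x hx) fun h => ha (hρ h ▸ hx)
    have h1 : {b ∈ insert a s | ρ b ≤ ρ a} = insert a s :=
      Finset.filter_true_of_mem fun b hb => by
        rcases Finset.mem_insert.1 hb with rfl | hb
        exacts [le_rfl, hmax b hb]
    have h2 : {b ∈ insert a s | ρ b < ρ a} = s := by
      rw [Finset.filter_insert, if_neg (lt_irrefl _), Finset.filter_true_of_mem hlt]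
    have h3 : ∀ x ∈ s, h {b ∈ insert a s | ρ b ≤ ρ x} - h {b ∈ insert a s | ρ b < ρ x} =
        h {b ∈ s | ρ b ≤ ρ x} - h {b ∈ s | ρ b < ρ x} := fun x hx => by
      rw [Finset.filter_insert, if_neg (hlt x hx).not_ge, Finset.filter_insert,
        if_neg (hlt x hx).le.not_gt]
    rw [Finset.sum_insert ha, Finset.sum_congr rfl h3, ih, h1, h2]
    ring

lemma IsPolymatroid.exists_marginals [Fintype V] {h : Finset V → ℝ} (hh : IsPolymatroid h)
    {ρ : V → ℕ} (hρ : Function.Injective ρ) :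
    ∃ v : V → ℝ, (∀ x, 0 ≤ v x) ∧
      (∀ x (A : Finset V), (∀ a ∈ A, ρ a < ρ x) → v x ≤ h (insert x A) - h A) ∧
      ∑ x, v x = h Finset.univ := by
  refine ⟨fun x => h {a | ρ a ≤ ρ x} - h {a | ρ a < ρ x}, fun x => ?_, fun x A hA => ?_, ?_⟩
  · refine sub_nonneg.2 (hh.mono _ _ (Finset.monotone_filter_right _ fun a _ ha => ?_))
    exact le_of_lt ha
  · have hsub := hh.submodular (insert x A) {a | ρ a < ρ x}
    have hu : insert x A ∪ ({a | ρ a < ρ x} : Finset V) = ({a | ρ a ≤ ρ x} : Finset V) := by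
      ext a
      simp only [Finset.mem_union, Finset.mem_insert, Finset.mem_filter, Finset.mem_univ, true_and]
      constructor
      · rintro ((rfl | ha) | ha)
        exacts [le_rfl, (hA a ha).le, ha.le]
      · intro ha
        rcases ha.lt_or_eq with ha | ha
        exacts [Or.inr ha, Or.inl (Or.inl (hρ ha))]
    have hi : insert x A ∩ ({a | ρ a < ρ x} : Finset V) = A := by
      ext a
      simp only [Finset.mem_inter, Finset.mem_insert, Finset.mem_filter, Finset.mem_univ, true_and]
      constructor
      · rintro ⟨rfl | ha, hlt⟩
        exacts [absurd hlt (lt_irrefl _), ha]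
      · exact fun ha => ⟨Or.inr ha, hA a ha⟩
    rw [hu, hi] at hsub
    linarith
  · rw [sum_marginals_eq h hρ, hh.zero_grounded, sub_zero]

end Marginals

/-! ### Edge weights and the shifting step -/

section Weights

variable {V : Type*} {E : V → V → Prop} {e : V → ℕ} {M L : ℝ} {v : V → ℝ}

/-- Nonnegative vertex weights with sum at most `M` along every edge and value at most `L` at every
vertex that is not a root. -/
structure IsEdgeWeight (E : V → V → Prop) (e : V → ℕ) (M L : ℝ) (v : V → ℝ) : Prop where
  nonneg : ∀ x, 0 ≤ v x
  add_le : ∀ x y, E x y → v x + v y ≤ M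
  le_of_not_isRoot : ∀ x, ¬ IsRoot E e x → v x ≤ L

/-- The weight of each root with an in-edge can be brought down to `max L (M - L)` without changing
the total weight. -/
lemma IsEdgeWeight.exists_shift [Fintype V] (hv : IsEdgeWeight E e M L v)
    (he : Function.Injective e) (hE : ∀ x, ¬ E x x) (hL : 0 ≤ L) :
    ∃ u, IsEdgeWeight E e M L u ∧ (∀ z r, IsRoot E e r → E z r → u r ≤ max L (M - L)) ∧
      ∑ x, u x = ∑ x, v x := by
  classical
  set T := max L (M - L)
  have hLT : L ≤ T := le_max_left _ _
  have hMT : M - L ≤ T := le_max_right _ _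
  -- `δ` is the amount taken from a root, `p` the in-neighbour that receives it.
  let N : V → Prop := fun r => IsRoot E e r ∧ ∃ z, E z r
  let δ : V → ℝ := fun r => if N r then max 0 (v r - T) else 0
  have hp : ∃ p : V → V, ∀ r, N r → E (p r) r :=
    ⟨fun r => if h : ∃ z, E z r then h.choose else r, fun r hr => by
      simp only [hr.2, dif_pos]
      exact hr.2.choose_spec⟩
  obtain ⟨p, hp⟩ := hp
  let σ : V → ℝ := fun x => ∑ r, if p r = x then δ r else 0
  have hδ0 : ∀ r, 0 ≤ δ r := fun r => by
    dsimp only [δ]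
    split_ifs
    exacts [le_max_left _ _, le_rfl]
  have hδv : ∀ r, δ r ≤ v r := fun r => by
    dsimp only [δ]
    split_ifs
    · exact max_le (hv.nonneg r) (by linarith)
    · exact hv.nonneg r
  have hN : ∀ r, δ r ≠ 0 → N r ∧ δ r = v r - T := fun r hr => by
    by_cases hn : N r
    · refine ⟨hn, ?_⟩
      simp only [δ, if_pos hn] at hr ⊢
      rcases max_choice 0 (v r - T) with h | h
      exacts [absurd h hr, h]
    · exact absurd (if_neg hn) hr
  have hσ : ∀ x, σ x = 0 ∨ ∃ r, N r ∧ p r = x ∧ σ x = v r - T := by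
    intro x
    by_cases hx : ∃ r, p r = x ∧ δ r ≠ 0
    · obtain ⟨r, hrx, hr⟩ := hx
      obtain ⟨hNr, hδr⟩ := hN r hr
      refine Or.inr ⟨r, hNr, hrx, ?_⟩
      have : σ x = if p r = x then δ r else 0 := by
        refine Finset.sum_eq_single r (fun s _ hs => ?_) (by simp)
        by_contra hne
        have hsx : p s = x := by
          by_contra h
          exact hne (if_neg h)
        rw [if_pos hsx] at hne
        have hNs := (hN s hne).1
        refine hs (hNs.1.eq_of_common_ancestor he hNr.1 (.single (hp s hNs)) ?_)
        rw [hsx, ← hrx]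
        exact .single (hp r hNr)
      rw [this, if_pos hrx, hδr]
    · push Not at hx
      left
      refine Finset.sum_eq_zero fun r _ => ?_
      split_ifs with h
      exacts [hx r h, rfl]
  -- A receiving vertex is a non-root neighbour of an overweight root, so it has room left.
  have hnotroot : ∀ r, N r → ¬ IsRoot E e (p r) := fun r hr hroot => by
    have heq : p r = r := hroot.eq_of_common_ancestor he hr.1 .refl (.single (hp r hr))
    have := hp r hr
    rw [heq] at this
    exact hE r this
  have hσroot : ∀ x, IsRoot E e x → σ x = 0 := fun x hx => by
    rcases hσ x with h | ⟨r, hr, rfl, -⟩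
    exacts [h, absurd hx (hnotroot r hr)]
  set u : V → ℝ := fun x => v x - δ x + σ x with hu
  have hule : ∀ x, σ x = 0 → u x ≤ v x := fun x hx => by
    have := hδ0 x
    simp only [hu, hx]
    linarith
  have hurec : ∀ x r, N r → p r = x → σ x = v r - T → u x ≤ M - T := fun x r hr hrx h => by
    have h1 := hv.add_le _ _ (hp r hr)
    have h2 := hδ0 x
    rw [hrx] at h1
    simp only [hu, h]
    linarith
  have hunon : ∀ x, ¬ IsRoot E e x → u x ≤ L := fun x hx => by
    rcases hσ x with h | ⟨r, hr, hrx, h⟩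
    · exact (hule x h).trans (hv.le_of_not_isRoot x hx)
    · have := hurec x r hr hrx h
      linarith
  have huroot : ∀ r, N r → u r ≤ T := fun r hr => by
    have h1 : δ r = max 0 (v r - T) := if_pos hr
    have h2 := le_max_right 0 (v r - T)
    simp only [hu, hσroot r hr.1, h1]
    linarith
  -- A vertex in the component of a root `r` with an in-edge carries at most `T`.
  have hucomp : ∀ r y, N r → ReflTransGen E y r → u y ≤ T := fun r y hr hyr => by
    by_cases hy : IsRoot E e y
    · rw [hy.eq_of_common_ancestor he hr.1 .refl hyr]
      exact huroot r hr
    · exact (hunon y hy).trans hLT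
  refine ⟨u, ⟨fun x => ?_, fun x y hxy => ?_, hunon⟩, fun z r hr hz => huroot r ⟨hr, z, hz⟩, ?_⟩
  · have h1 := hδv x
    have h2 : 0 ≤ σ x := Finset.sum_nonneg fun r _ => by
      split_ifs
      exacts [hδ0 r, le_rfl]
    simp only [hu]
    linarith
  · rcases hσ x with hx | ⟨r, hr, hrx, h⟩
    · rcases hσ y with hy | ⟨r, hr, hry, h⟩
      · exact (add_le_add (hule x hx) (hule y hy)).trans (hv.add_le x y hxy)
      · have h1 := hurec y r hr hry h
        have h2 : u x ≤ T := hucomp r x hr (.head hxy (hry ▸ .single (hp r hr)))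
        linarith
    · have h1 := hurec x r hr hrx h
      have h2 : u y ≤ T := by
        by_cases hy : IsRoot E e y
        · refine hucomp r y hr ?_
          have hxr : ReflTransGen E x r := hrx ▸ .single (hp r hr)
          rw [hy.eq_of_common_ancestor he hr.1 (.single hxy) hxr]
        · exact (hunon y hy).trans hLT
      linarith
  · have hsum : ∑ x, σ x = ∑ r, δ r := by
      simp only [σ]
      rw [Finset.sum_comm]
      simp
    simp only [hu, Finset.sum_add_distrib, Finset.sum_sub_distrib, hsum]
    ring

end Weights

/-! ### Polymatroids with shared weight -/

section Shared

open Classical in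
/-- Every element `x` of a set costs `w x`, and for each `r` the amount `ε r` is paid once if the
set meets `{y | B y r}`. -/
noncomputable def sharedWeight {V : Type*} [Fintype V] (B : V → V → Prop) (w ε : V → ℝ)
    (S : Finset V) : ℝ :=
  ∑ x ∈ S, w x + ∑ r, if ∃ y ∈ S, B y r then ε r else 0

variable {V : Type*} [DecidableEq V] [Fintype V]

lemma isPolymatroid_sharedWeight (B : V → V → Prop) {w ε : V → ℝ} (hw : ∀ x, 0 ≤ w x)
    (hε : ∀ x, 0 ≤ ε x) : IsPolymatroid (sharedWeight B w ε) where
  nonneg X := by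
    classical
    refine add_nonneg (Finset.sum_nonneg fun x _ => hw x) (Finset.sum_nonneg fun r _ => ?_)
    split_ifs
    exacts [hε r, le_rfl]
  zero_grounded := by simp [sharedWeight]
  mono X Y hXY := by
    classical
    refine add_le_add (Finset.sum_le_sum_of_subset_of_nonneg hXY fun x _ _ => hw x)
      (Finset.sum_le_sum fun r _ => ?_)
    by_cases hX : ∃ y ∈ X, B y r
    · obtain ⟨y, hy, hyr⟩ := hX
      rw [if_pos ⟨y, hy, hyr⟩, if_pos ⟨y, hXY hy, hyr⟩]
    · rw [if_neg hX]
      split_ifs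
      exacts [hε r, le_rfl]
  submodular X Y := by
    classical
    have h1 := Finset.sum_union_inter (s₁ := X) (s₂ := Y) (f := w)
    have h2 : (∑ r, if ∃ y ∈ X ∪ Y, B y r then ε r else 0) +
        (∑ r, if ∃ y ∈ X ∩ Y, B y r then ε r else 0) ≤
        (∑ r, if ∃ y ∈ X, B y r then ε r else 0) + ∑ r, if ∃ y ∈ Y, B y r then ε r else 0 := by
      rw [← Finset.sum_add_distrib, ← Finset.sum_add_distrib]
      refine Finset.sum_le_sum fun r _ => ?_
      have hr := hε r
      by_cases hX : ∃ y ∈ X, B y r <;> by_cases hY : ∃ y ∈ Y, B y r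
      · rw [if_pos hX, if_pos hY]
        split_ifs <;> linarith
      all_goals
        have hi : ¬ ∃ y ∈ X ∩ Y, B y r := by
          rintro ⟨y, hy, hyr⟩
          rw [Finset.mem_inter] at hy
          first
            | exact hX ⟨y, hy.1, hyr⟩
            | exact hY ⟨y, hy.2, hyr⟩
        rw [if_neg hi]
      · rw [if_pos hX, if_neg hY]
        split_ifs <;> linarith
      · rw [if_neg hX, if_pos hY]
        split_ifs <;> linarith
      · have hu : ¬ ∃ y ∈ X ∪ Y, B y r := by
          rintro ⟨y, hy, hyr⟩
          rcases Finset.mem_union.1 hy with hy | hy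
          exacts [hX ⟨y, hy, hyr⟩, hY ⟨y, hy, hyr⟩]
        rw [if_neg hX, if_neg hY, if_neg hu]
    simp only [sharedWeight]
    linarith

/-- If the roots with an in-edge weigh at most `max L (M - L)`, then some polymatroid of the same
total obeys all the constraints along the edges. -/
lemma IsEdgeWeight.exists_feasible {E : V → V → Prop} {e : V → ℕ} {M L : ℝ} {u : V → ℝ}
    (hu : IsEdgeWeight E e M L u) (he : Function.Injective e) (hE : ∀ x, ¬ E x x) (hL : 0 ≤ L)
    (hroot : ∀ z r, IsRoot E e r → E z r → u r ≤ max L (M - L)) :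
    ∃ h : Finset V → ℝ, IsPolymatroid h ∧
      (∀ x y, E x y → h {x, y} ≤ M ∧ h {x, y} - h {x} ≤ L) ∧ h Finset.univ = ∑ x, u x := by
  classical
  let ε : V → ℝ := fun r => if IsRoot E e r then max 0 (u r - L) else 0
  have hε0 : ∀ r, 0 ≤ ε r := fun r => by
    dsimp only [ε]
    split_ifs
    exacts [le_max_left _ _, le_rfl]
  have hε : ∀ r, ε r ≠ 0 → IsRoot E e r ∧ ε r = u r - L ∧ 0 < u r - L := fun r hr => by
    by_cases hn : IsRoot E e r
    · simp only [ε, if_pos hn] at hr ⊢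
      rcases le_or_gt (u r - L) 0 with h | h
      · exact absurd (max_eq_left h) hr
      · exact ⟨hn, max_eq_right h.le, h⟩
    · exact absurd (if_neg hn) hr
  let w : V → ℝ := fun x => u x - ε x
  have hwu : ∀ x, w x ≤ u x := fun x => sub_le_self _ (hε0 x)
  have hwL : ∀ x, w x ≤ L := fun x => by
    by_cases hx : IsRoot E e x
    · have h1 : ε x = max 0 (u x - L) := if_pos hx
      have h2 := le_max_right 0 (u x - L)
      simp only [w, h1]
      linarith
    · exact (hwu x).trans (hu.le_of_not_isRoot x hx)
  have hw0 : ∀ x, 0 ≤ w x := fun x => by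
    by_cases hx : ε x = 0
    · simp only [w, hx, sub_zero]
      exact hu.nonneg x
    · simp only [w, (hε x hx).2.1]
      linarith
  -- Along an edge the shared weight is determined by the source.
  have hpair : ∀ x y, E x y → sharedWeight (ReflTransGen E) w ε {x, y} =
      w x + w y + ∑ r, if ReflTransGen E x r then ε r else 0 := fun x y hxy => by
    have hne : x ≠ y := fun h => hE y (h ▸ hxy)
    simp only [sharedWeight, Finset.sum_pair hne]
    congr 1
    refine Finset.sum_congr rfl fun r _ => if_congr ?_ rfl rfl
    simp only [Finset.mem_insert, Finset.mem_singleton, exists_eq_or_imp, exists_eq_left]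
    exact ⟨fun h => h.elim id fun h => .head hxy h, Or.inl⟩
  refine ⟨sharedWeight (ReflTransGen E) w ε, isPolymatroid_sharedWeight _ hw0 hε0,
    fun x y hxy => ⟨?_, ?_⟩, ?_⟩
  · rw [hpair x y hxy]
    by_cases hx : ∃ r, ReflTransGen E x r ∧ ε r ≠ 0
    · obtain ⟨r, hxr, hr⟩ := hx
      obtain ⟨hr1, hr2, hr3⟩ := hε r hr
      have hsum : (∑ s, if ReflTransGen E x s then ε s else 0) = ε r := by
        rw [Finset.sum_eq_single r, if_pos hxr]
        · intro s _ hs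
          by_contra hne
          have hxs : ReflTransGen E x s := by
            by_contra h
            exact hne (if_neg h)
          rw [if_pos hxs] at hne
          exact hs ((hε s hne).1.eq_of_common_ancestor he hr1 hxs hxr)
        · simp
      rw [hsum]
      by_cases hin : ∃ z, E z r
      · obtain ⟨z, hz⟩ := hin
        have h1 : u r ≤ M - L := (le_max_iff.1 (hroot z r hr1 hz)).resolve_left (by linarith)
        have h2 := hwL x
        have h3 := hwL y
        linarith
      · -- A root without in-edges shares its weight with no other vertex.
        have hxr' : x = r := by
          rcases ReflTransGen.cases_tail hxr with h | ⟨z, -, hz⟩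
          exacts [h.symm, absurd ⟨z, hz⟩ hin]
        subst hxr'
        have h1 := hu.add_le x y hxy
        have h2 := hwu y
        have h3 : w x = u x - ε x := rfl
        linarith
    · push Not at hx
      have hsum : (∑ s, if ReflTransGen E x s then ε s else 0) = 0 :=
        Finset.sum_eq_zero fun s _ => by
          split_ifs with h
          exacts [hx s h, rfl]
      have h1 := hu.add_le x y hxy
      have h2 := hwu x
      have h3 := hwu y
      linarith
  · have hsingle : sharedWeight (ReflTransGen E) w ε {x} =
        w x + ∑ r, if ReflTransGen E x r then ε r else 0 := by
      simp [sharedWeight]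
    rw [hpair x y hxy, hsingle]
    have := hwL y
    linarith
  · have hall : ∀ r, ∃ y ∈ Finset.univ, ReflTransGen E y r :=
      fun r => ⟨r, Finset.mem_univ r, .refl⟩
    simp only [sharedWeight, if_pos (hall _), ← Finset.sum_add_distrib, w, sub_add_cancel]

end Shared

/-! ### Existence of the maximum -/

section Existence

variable {V : Type*} [DecidableEq V]

lemma IsPolymatroid.le_sum_singleton {h : Finset V → ℝ} (hh : IsPolymatroid h) (S : Finset V) :
    h S ≤ ∑ x ∈ S, h {x} := by
  induction S using Finset.induction_on with
  | empty => simp [hh.zero_grounded]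
  | insert a S ha ih =>
    have h1 := hh.submodular {a} S
    have h2 := hh.nonneg ({a} ∩ S)
    rw [Finset.sum_insert ha, Finset.insert_eq]
    linarith

lemma zero_mem_feasible (DC : Set (DegreeConstraint V)) : (fun _ => 0) ∈ feasible DC := by
  refine ⟨⟨fun _ => le_rfl, rfl, fun _ _ _ => le_rfl, fun _ _ => le_rfl⟩, fun c _ => ?_⟩
  rw [sub_zero]
  exact Real.logb_nonneg one_lt_two (by exact_mod_cast c.one_le_bound)

lemma isClosed_feasible (DC : Set (DegreeConstraint V)) : IsClosed (feasible DC) := by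
  have : feasible DC = {h | (∀ X, 0 ≤ h X) ∧ h ∅ = 0 ∧ (∀ X Y, X ⊆ Y → h X ≤ h Y) ∧
      (∀ X Y, h (X ∪ Y) + h (X ∩ Y) ≤ h X + h Y) ∧
      ∀ c ∈ DC, h c.upper - h c.lower ≤ Real.logb 2 c.bound} := by
    ext h
    exact ⟨fun ⟨⟨a, b, c, d⟩, f⟩ => ⟨a, b, c, d, f⟩, fun ⟨a, b, c, d, f⟩ => ⟨⟨a, b, c, d⟩, f⟩⟩
  rw [this]
  simp only [Set.ofPred_and, Set.ofPred_forall]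
  refine IsClosed.inter ?_ (IsClosed.inter ?_ (IsClosed.inter ?_ (IsClosed.inter ?_ ?_)))
  · exact isClosed_iInter fun X => isClosed_le (by fun_prop) (by fun_prop)
  · exact isClosed_eq (by fun_prop) (by fun_prop)
  · exact isClosed_iInter fun X => isClosed_iInter fun Y => isClosed_iInter fun _ =>
      isClosed_le (by fun_prop) (by fun_prop)
  · exact isClosed_iInter fun X => isClosed_iInter fun Y =>
      isClosed_le (by fun_prop) (by fun_prop)
  · exact isClosed_iInter fun c => isClosed_iInter fun _ =>
      isClosed_le (by fun_prop) (by fun_prop)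

/-- The feasible set is compact as soon as each attribute occurs in a cardinality constraint. -/
lemma polymatExists_of_cover [Fintype V] {DC : Set (DegreeConstraint V)}
    (hDC : ∀ x, ∃ c ∈ DC, c.lower = ∅ ∧ x ∈ c.upper) : PolymatExists DC := by
  choose c hc hlow hup using hDC
  let K : ℝ := ∑ x, Real.logb 2 (c x).bound
  have hbound : ∀ h ∈ feasible DC, ∀ S, h S ≤ K := by
    rintro h ⟨hh, hDC⟩ S
    refine (hh.mono S _ (Finset.subset_univ S)).trans ((hh.le_sum_singleton _).trans ?_)
    refine Finset.sum_le_sum fun x _ => ?_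
    have h1 := hDC (c x) (hc x)
    rw [hlow, hh.zero_grounded, sub_zero] at h1
    exact (hh.mono _ _ (Finset.singleton_subset_iff.2 (hup x))).trans h1
  have hcomp : IsCompact (feasible DC) :=
    (isCompact_univ_pi fun _ : Finset V => isCompact_Icc (a := (0 : ℝ)) (b := K)).of_isClosed_subset
      (isClosed_feasible DC) fun h hh S _ => ⟨hh.1.nonneg S, hbound h hh S⟩
  obtain ⟨h, hh, hmax⟩ := hcomp.exists_isMaxOn ⟨_, zero_mem_feasible DC⟩
    (f := fun h => h Finset.univ) (continuous_apply _).continuousOn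
  exact ⟨h, hh, fun h' hh' => hmax hh'⟩

end Existence

/-! ### The acyclic subset -/

section Levels

variable {V : Type*} [DecidableEq V]

/-- The constraints whose dependencies all go to a strictly higher level of `d`. -/
def levelConstraints (DC : Set (DegreeConstraint V)) (d : V → ℕ) : Set (DegreeConstraint V) :=
  {c ∈ DC | ∀ x ∈ c.lower, ∀ y ∈ c.upper \ c.lower, d x < d y}

lemma acyclicConstraints_levelConstraints (DC : Set (DegreeConstraint V)) (d : V → ℕ) :
    AcyclicConstraints (levelConstraints DC d) := by
  intro v hv
  have hlt : ∀ x y, TransGen (dependencyGraph (levelConstraints DC d)).Adj x y → d x < d y := by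
    intro x y hxy
    have hstep : ∀ a b, (dependencyGraph (levelConstraints DC d)).Adj a b → d a < d b :=
      fun a b ⟨c, hc, ha, hb⟩ => hc.2 a ha b hb
    induction hxy with
    | single h => exact hstep _ _ h
    | tail _ h ih => exact ih.trans (hstep _ _ h)
  exact lt_irrefl _ (hlt v v hv)

variable {P : Digraph V} {m lam : ℕ}

/-- The constraint `(∅, {x, y}, m)`. -/
def pairConstraint (x y : V) (hm : 1 ≤ m) : DegreeConstraint V where
  lower := ∅
  upper := {x, y}
  bound := m
  lower_ssubset_upper := Finset.empty_ssubset.2 (Finset.insert_nonempty _ _)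
  one_le_bound := hm

/-- The constraint `({x}, {x, y}, lam)`. -/
def degreeConstraint (x y : V) (hxy : x ≠ y) (hlam : 1 ≤ lam) : DegreeConstraint V where
  lower := {x}
  upper := {x, y}
  bound := lam
  lower_ssubset_upper := by
    rw [Finset.ssubset_iff_of_subset (by simp)]
    exact ⟨y, by simp, by simpa using hxy.symm⟩
  one_le_bound := hlam

lemma pairConstraint_mem (d : V → ℕ) (hm : 1 ≤ m) {x y : V} (hxy : P.Adj x y) :
    pairConstraint x y hm ∈ levelConstraints (patternConstraints P m lam) d :=
  ⟨⟨x, y, hxy, Or.inl ⟨rfl, rfl, rfl⟩⟩, fun _ ha => absurd ha (Finset.notMem_empty _)⟩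

lemma degreeConstraint_mem (d : V → ℕ) (hlam : 1 ≤ lam) {x y : V} (hxy : P.Adj x y) (hne : x ≠ y)
    (hd : d x < d y) :
    degreeConstraint x y hne hlam ∈ levelConstraints (patternConstraints P m lam) d := by
  refine ⟨⟨x, y, hxy, Or.inr ⟨rfl, rfl, rfl⟩⟩, fun a ha b hb => ?_⟩
  simp only [degreeConstraint, Finset.mem_singleton, Finset.mem_sdiff, Finset.mem_insert] at ha hb
  obtain ⟨rfl | rfl, h⟩ := hb
  · exact absurd rfl h
  · rwa [ha]

variable [Fintype V]

/-- A polymatroid that obeys the cardinality constraints, and a degree constraint into each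
non-root, has the value on `univ` of a polymatroid that obeys all the constraints. -/
lemma exists_feasible_of_levelConstraints {e d : V → ℕ} (he : Function.Injective e)
    (hP : ∀ x, ¬ P.Adj x x) (hm : 1 ≤ m) (hlam : 1 ≤ lam)
    (hd : ∀ y, ¬ IsRoot P.Adj e y → ∃ x, P.Adj x y ∧ d x < d y) {h : Finset V → ℝ}
    (hh : h ∈ feasible (levelConstraints (patternConstraints P m lam) d)) :
    ∃ g ∈ feasible (patternConstraints P m lam), g Finset.univ = h Finset.univ := by
  obtain ⟨hpoly, hcon⟩ := hh
  obtain ⟨ρ, hρ, hdρ⟩ := exists_injective_refinement d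
  obtain ⟨v, hv0, hvle, hvsum⟩ := hpoly.exists_marginals hρ
  have hL : 0 ≤ Real.logb 2 lam := Real.logb_nonneg one_lt_two (by exact_mod_cast hlam)
  have hpair : ∀ x y, P.Adj x y → h {x, y} ≤ Real.logb 2 m := fun x y hxy => by
    have := hcon _ (pairConstraint_mem d hm hxy)
    simpa only [pairConstraint, hpoly.zero_grounded, sub_zero] using this
  have hadd : ∀ x y, ρ x < ρ y → v x + v y ≤ h {x, y} := fun x y hxy => by
    have h1 := hvle x ∅ (by simp)
    have h2 := hvle y {x} (by simpa using hxy)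
    rw [hpoly.zero_grounded, insert_empty_eq] at h1
    rw [Finset.pair_comm] at h2
    linarith
  have hweight : IsEdgeWeight P.Adj e (Real.logb 2 m) (Real.logb 2 lam) v := by
    refine ⟨hv0, fun x y hxy => ?_, fun y hy => ?_⟩
    · have hne : ρ x ≠ ρ y := fun h => hP y (by rwa [hρ h] at hxy)
      rcases hne.lt_or_gt with h | h
      · exact (hadd x y h).trans (hpair x y hxy)
      · rw [add_comm]
        refine (hadd y x h).trans ?_
        rw [Finset.pair_comm]
        exact hpair x y hxy
    · obtain ⟨x, hxy, hlt⟩ := hd y hy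
      have hne : x ≠ y := fun h => hlt.ne (h ▸ rfl)
      have h1 := hcon _ (degreeConstraint_mem d hlam hxy hne hlt)
      have h2 := hvle y {x} (by simpa using hdρ x y hlt)
      simp only [degreeConstraint] at h1
      rw [Finset.pair_comm] at h2
      exact h2.trans h1
  obtain ⟨u, hu, huroot, husum⟩ := hweight.exists_shift he hP hL
  obtain ⟨g, hg, hgE, hgsum⟩ := hu.exists_feasible he hP hL huroot
  refine ⟨g, ⟨hg, ?_⟩, by rw [hgsum, husum, hvsum]⟩
  rintro c ⟨x, y, hxy, ⟨h1, h2, h3⟩ | ⟨h1, h2, h3⟩⟩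
  · rw [h1, h2, h3, hg.zero_grounded, sub_zero]
    exact (hgE x y hxy).1
  · rw [h1, h2, h3]
    exact (hgE x y hxy).2

end Levels

end DegreeJoin

open DegreeJoin in
theorem mainTheorem3 (k : ℕ) :
    ∃ c C : ℝ, 0 < c ∧ 0 < C ∧
      ∀ (V : Type*) [Fintype V] [DecidableEq V], Fintype.card V = k →
      ∀ (P : Digraph V), (∀ v, ¬ P.Adj v v) → P.toSimpleGraphInclusive.Connected →
      ∀ (m lam : ℕ), 1 ≤ m → 1 ≤ lam → lam ≤ m →
      ¬ DegreeJoin.AcyclicConstraints (DegreeJoin.patternConstraints P m lam) →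
      DegreeJoin.PolymatExists (DegreeJoin.patternConstraints P m lam) ∧
      ∃ DC' : Set (DegreeJoin.DegreeConstraint V),
        DC' ⊂ DegreeJoin.patternConstraints P m lam ∧
        DegreeJoin.AcyclicConstraints DC' ∧
        DegreeJoin.PolymatExists DC' ∧
        c * DegreeJoin.polymat (DegreeJoin.patternConstraints P m lam) ≤ DegreeJoin.polymat DC' ∧
        DegreeJoin.polymat DC' ≤ C * DegreeJoin.polymat (DegreeJoin.patternConstraints P m lam) := by
  refine ⟨1, 1, one_pos, one_pos, ?_⟩
  intro V _ _ _ P hP hconn m lam hm hlam _ hcyc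
  -- A cycle needs two vertices, so by connectedness every vertex lies on an edge.
  have : Nontrivial V := by
    by_contra hV
    rw [not_nontrivial_iff_subsingleton] at hV
    refine hcyc fun v hv => ?_
    obtain ⟨y, ⟨c, -, h1, h2⟩, -⟩ := Relation.TransGen.head'_iff.1 hv
    rw [Subsingleton.elim y v] at h2
    exact (Finset.mem_sdiff.1 h2).2 h1
  let e : V → ℕ := fun x => Fintype.equivFin V x
  have he : Function.Injective e := Fin.val_injective.comp (Fintype.equivFin V).injective
  obtain ⟨d, hd⟩ := exists_level (R := IsRoot P.Adj e) (fun x => exists_isRoot_reaching x)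
  set DC := patternConstraints P m lam
  have hcover : ∀ x, ∃ c ∈ levelConstraints DC d, c.lower = ∅ ∧ x ∈ c.upper := fun x => by
    obtain ⟨y, -, hy | hy⟩ := hconn.preconnected.exists_adj_of_nontrivial x
    · exact ⟨_, pairConstraint_mem d hm hy, rfl, by simp [pairConstraint]⟩
    · exact ⟨_, pairConstraint_mem d hm hy, rfl, by simp [pairConstraint]⟩
  have hsub : levelConstraints DC d ⊆ DC := fun c hc => hc.1
  have hacyc := acyclicConstraints_levelConstraints DC d
  have hpolymat : polymat (levelConstraints DC d) = polymat DC := by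
    have himage : (fun h : Finset V → ℝ => h Finset.univ) '' feasible (levelConstraints DC d) =
        (fun h : Finset V → ℝ => h Finset.univ) '' feasible DC := by
      refine Set.Subset.antisymm ?_ (Set.image_mono fun h hh => ⟨hh.1, fun c hc => hh.2 c hc.1⟩)
      rintro _ ⟨h, hh, rfl⟩
      exact exists_feasible_of_levelConstraints he hP hm hlam hd hh
    rw [polymat, polymat, himage]
  refine ⟨polymatExists_of_cover fun x => ?_, levelConstraints DC d,
    hsub.ssubset_of_ne fun h => hcyc (h ▸ hacyc), hacyc, polymatExists_of_cover hcover, ?_, ?_⟩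
  · obtain ⟨c, hc, hx⟩ := hcover x
    exact ⟨c, hsub hc, hx⟩
  · rw [hpolymat, one_mul]
  · rw [hpolymat, one_mul]
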